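/- Let $d\ge 1$, and let $p_1,p_2$ denote the projections of $\mathbb{R}^d\times\mathbb{R}$ onto $\mathbb{R}^d$ and $\mathbb{R}$. Let $\Gamma\subset\mathbb{R}^d\times\mathbb{R}$ be a (full-rank) lattice such that $p_1|_\Gamma$ and $p_2|_\Gamma$ are injective and $p_1(\Gamma)$, $p_2(\Gamma)$ are dense in $\mathbb{R}^d$, $\mathbb{R}$. Let $\det\Gamma$ be its covolume and $\Gamma^*=\{y : \langle x,y\rangle\in\mathbb{Z}\ \text{for all } x\in\Gamma\}$ its dual lattice. Let $a<b$, let $I=[a,b)$ or $I=(a,b]$, write $|I|=b-a$, assume $|I|\in p_2(\Gamma)$, and put $$\Lambda=\Lambda(\Gamma,I)=\{p_1(\gamma) : \gamma\in\Gamma,\ p_2(\gamma)\in I\}.$$ For a set $\Lambda\subset\mathbb{R}^d$ let $$\mathscr{D}^-(\Lambda)=\liminf_{R\to\infty}\inf_{x\in\mathbb{R}^d}\frac{\#(\Lambda\cap(x+B_R))}{|B_R|},\qquad \mathscr{D}^+(\Lambda)=\limsup_{R\to\infty}\sup_{x\in\mathbb{R}^d}\frac{\#(\Lambda\cap(x+B_R))}{|B_R|},$$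 where $B_R$ is the ball of radius $R$ centered at the origin; if these two are equal, the common value is the uniform density $\mathscr{D}(\Lambda)$. A bounded set $S\subset\mathbb{R}^d$ is called Riemann measurable if its boundary has Lebesgue measure zero. Given a group $G\subset\mathbb{R}^d$ of vectors, two Riemann measurable sets $S,S'$ are called equidecomposable using only translations by vectors in $G$ if $S$ can be partitioned into finitely many Riemann measurable subsets which, after translation by suitable vectors of $G$, form, up to measure zero, a partition of $S'$. Then $\Lambda$ has a uniform density, equal to $\mathscr{D}(\Lambda)=|I|/\det\Gamma$. Moreover, if $K$ is a compact set and $U$ an open set in $\mathbb{R}^d$ with $K\subset U$ and $\operatorname{mes}K<\mathscr{D}(\Lambda)<\operatorname{mes}U$, then there is a Riemann measurable set $S$ with $K\subset S\subset U$ such that 1. $\operatorname{mes}S=\mathscr{D}(\Lambda)$; 2. $S$ is equidecomposable to a parallelepiped spanned by $d$ linearly independent vectors in $p_1(\Gamma^*)$, using only translations by vectors in $p_1(\Gamma^*)$. -/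

import Mathlib

open Set Filter MeasureTheory
open scoped ENNReal Pointwise RealInnerProductSpace

namespace Quasicrystal

/-- The lattice `Γ ⊆ ℝᵈ × ℝ` is in general position: both coordinate projections are injective
on `Γ` and have dense image. -/
structure GeneralPosition {d : ℕ} (Γ : Submodule ℤ (EuclideanSpace ℝ (Fin d) × ℝ)) : Prop where
  injOn_fst : Set.InjOn Prod.fst (Γ : Set (EuclideanSpace ℝ (Fin d) × ℝ))
  injOn_snd : Set.InjOn Prod.snd (Γ : Set (EuclideanSpace ℝ (Fin d) × ℝ))
  dense_fst : Dense (Prod.fst '' (Γ : Set (EuclideanSpace ℝ (Fin d) × ℝ)))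
  dense_snd : Dense (Prod.snd '' (Γ : Set (EuclideanSpace ℝ (Fin d) × ℝ)))

/-- The dual lattice `Γ*`: all vectors whose Euclidean inner product in `ℝᵈ × ℝ = ℝᵈ⁺¹` with
every vector of `Γ` is an integer. -/
def dualLattice {d : ℕ} (Γ : Submodule ℤ (EuclideanSpace ℝ (Fin d) × ℝ)) :
    AddSubgroup (EuclideanSpace ℝ (Fin d) × ℝ) where
  carrier := {y | ∀ x ∈ Γ, ∃ n : ℤ, ⟪x.1, y.1⟫ + x.2 * y.2 = (n : ℝ)}
  zero_mem' := fun x _ => ⟨0, by simp⟩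
  add_mem' := by
    intro y z hy hz x hx
    obtain ⟨m, hm⟩ := hy x hx
    obtain ⟨n, hn⟩ := hz x hx
    refine ⟨m + n, ?_⟩
    rw [Prod.fst_add, Prod.snd_add, inner_add_right]
    push_cast
    linarith
  neg_mem' := by
    intro y hy x hx
    obtain ⟨m, hm⟩ := hy x hx
    refine ⟨-m, ?_⟩
    rw [Prod.fst_neg, Prod.snd_neg, inner_neg_right]
    push_cast
    linarith

/-- The group `p₁(Γ*) ⊆ ℝᵈ`. -/
def dualProj {d : ℕ} (Γ : Submodule ℤ (EuclideanSpace ℝ (Fin d) × ℝ)) :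
    AddSubgroup (EuclideanSpace ℝ (Fin d)) :=
  (dualLattice Γ).map (AddMonoidHom.fst (EuclideanSpace ℝ (Fin d)) ℝ)

/-- The cut-and-project set `Λ(Γ, I) = {p₁(γ) : γ ∈ Γ, p₂(γ) ∈ I}`. -/
def modelSet {d : ℕ} (Γ : Submodule ℤ (EuclideanSpace ℝ (Fin d) × ℝ)) (I : Set ℝ) :
    Set (EuclideanSpace ℝ (Fin d)) :=
  {x | ∃ γ ∈ Γ, γ.2 ∈ I ∧ γ.1 = x}

/-- The Beurling lower uniform density. -/
noncomputable def lowerDensity {d : ℕ} (Λ : Set (EuclideanSpace ℝ (Fin d))) : ℝ≥0∞ :=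
  liminf (fun R : ℝ => ⨅ x : EuclideanSpace ℝ (Fin d),
    ((Λ ∩ Metric.ball x R).encard : ℝ≥0∞) /
      volume (Metric.ball (0 : EuclideanSpace ℝ (Fin d)) R)) atTop

/-- The Beurling upper uniform density. -/
noncomputable def upperDensity {d : ℕ} (Λ : Set (EuclideanSpace ℝ (Fin d))) : ℝ≥0∞ :=
  limsup (fun R : ℝ => ⨆ x : EuclideanSpace ℝ (Fin d),
    ((Λ ∩ Metric.ball x R).encard : ℝ≥0∞) /
      volume (Metric.ball (0 : EuclideanSpace ℝ (Fin d)) R)) atTop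

/-- `Λ` has uniform density `D`: the lower and upper densities are both equal to `D`. -/
def HasUniformDensity {d : ℕ} (Λ : Set (EuclideanSpace ℝ (Fin d))) (D : ℝ≥0∞) : Prop :=
  lowerDensity Λ = D ∧ upperDensity Λ = D

/-- A bounded set whose boundary has Lebesgue measure zero. -/
def RiemannMeasurable {d : ℕ} (S : Set (EuclideanSpace ℝ (Fin d))) : Prop :=
  Bornology.IsBounded S ∧ volume (frontier S) = 0

/-- `S` can be partitioned into finitely many Riemann measurable subsets, whose translates by
suitable vectors of the group `G` form, up to measure zero, a partition of `S'`. -/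
def EquidecomposableByTranslations {d : ℕ} (G : AddSubgroup (EuclideanSpace ℝ (Fin d)))
    (S S' : Set (EuclideanSpace ℝ (Fin d))) : Prop :=
  ∃ (N : ℕ) (A : Fin N → Set (EuclideanSpace ℝ (Fin d))) (v : Fin N → EuclideanSpace ℝ (Fin d)),
    (∀ i, RiemannMeasurable (A i)) ∧
    Pairwise (fun i j => Disjoint (A i) (A j)) ∧
    (⋃ i, A i) = S ∧
    (∀ i, v i ∈ G) ∧
    Pairwise (fun i j => AEDisjoint volume (v i +ᵥ A i) (v j +ᵥ A j)) ∧
    (⋃ i, (v i +ᵥ A i)) =ᵐ[volume] S'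

end Quasicrystal

/-!
Let `ℓ` be the length of the window. The cells of `Γ` attached to the lattice points `γ` with
`γ.2 ∈ I` and a straight strip of width `ℓ` are both fundamental domains of the cyclic group
generated by a lattice vector of height `ℓ`. An oblique cylinder along that vector thus meets them
in the same volume, so counting the lattice points in it gives the uniform density `ℓ / det Γ`.

By the complementary minor identity, `d` vectors of the basis dual to `e₁, …, e_d, e_{d+1}` project
to a parallelepiped of volume `|p₂(e_{d+1})| / det Γ`. Choosing the basis so that the vector of
height `ℓ` is a multiple of `e_{d+1}` and rescaling one dual vector by that multiple produces a
parallelepiped `P` spanned by vectors of `p₁(Γ*)` whose volume is the density.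

The group `p₁(Γ*)` is dense: otherwise Kronecker's theorem gives `u ≠ 0` pairing integrally with
it, that is, `(u, 0) ∈ Γ** = Γ`, against the injectivity of `p₂`. A dense group of translations
moves any Riemann measurable set, cut along a fine grid, into any open set of larger volume.
Applying this first to a neighbourhood `A` of `K` and the interior of `P`, and then to what remains
of `P` and `U \ closure A`, gives `S`.
-/

namespace Quasicrystal

/-! ### Riemann measurable sets and equidecomposability -/

section Equidecomposability

variable {d : ℕ} {G : AddSubgroup (EuclideanSpace ℝ (Fin d))}
  {A A' B B' K U V : Set (EuclideanSpace ℝ (Fin d))}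

lemma RiemannMeasurable.nullMeasurableSet (hA : RiemannMeasurable A) :
    NullMeasurableSet A volume :=
  nullMeasurableSet_of_null_frontier hA.2

lemma RiemannMeasurable.inter_of_null_frontier (hA : RiemannMeasurable A)
    (hB : volume (frontier B) = 0) : RiemannMeasurable (A ∩ B) :=
  ⟨hA.1.subset inter_subset_left, null_frontier_inter hA.2 hB⟩

lemma RiemannMeasurable.diff (hA : RiemannMeasurable A) (hB : RiemannMeasurable B) :
    RiemannMeasurable (A \ B) :=
  hA.inter_of_null_frontier (B := Bᶜ) (by rw [frontier_compl, hB.2])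

lemma RiemannMeasurable.union (hA : RiemannMeasurable A) (hB : RiemannMeasurable B) :
    RiemannMeasurable (A ∪ B) := by
  refine ⟨hA.1.union hB.1, ?_⟩
  rw [← frontier_compl, compl_union]
  exact null_frontier_inter (by rw [frontier_compl, hA.2]) (by rw [frontier_compl, hB.2])

lemma RiemannMeasurable.iUnion {ι : Type*} [Finite ι] {A : ι → Set (EuclideanSpace ℝ (Fin d))}
    (hA : ∀ i, RiemannMeasurable (A i)) : RiemannMeasurable (⋃ i, A i) := by
  have biUnion : ∀ s : Set ι, s.Finite → RiemannMeasurable (⋃ i ∈ s, A i) := fun s hs => by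
    induction s, hs using Set.Finite.induction_on with
    | empty => simp [RiemannMeasurable]
    | insert _ _ ih => rw [biUnion_insert]; exact (hA _).union ih
  simpa using biUnion univ finite_univ

lemma RiemannMeasurable.vadd (hA : RiemannMeasurable A) (v : EuclideanSpace ℝ (Fin d)) :
    RiemannMeasurable (v +ᵥ A) := by
  have frontier_vadd : frontier (v +ᵥ A) = v +ᵥ frontier A :=
    ((Homeomorph.addLeft v).image_frontier A).symm
  exact ⟨hA.1.vadd v, by rw [frontier_vadd, measure_vadd, hA.2]⟩

lemma RiemannMeasurable.of_convex (hA : Convex ℝ A) (hb : Bornology.IsBounded A) :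
    RiemannMeasurable A :=
  ⟨hb, hA.addHaar_frontier _⟩

/-- Equidecomposability by translations in `G`, with Riemann measurable pieces, in the strict sense:
the translated pieces are disjoint and cover `B` exactly, and not only up to measure zero. In this
form the relation is visibly symmetric and compatible with disjoint unions. -/
def StrictlyEquidecomposable (G : AddSubgroup (EuclideanSpace ℝ (Fin d)))
    (A B : Set (EuclideanSpace ℝ (Fin d))) : Prop :=
  ∃ (ι : Type) (_ : Finite ι) (P : ι → Set (EuclideanSpace ℝ (Fin d)))
    (v : ι → EuclideanSpace ℝ (Fin d)),
    (∀ i, RiemannMeasurable (P i)) ∧ Pairwise (Function.onFun Disjoint P) ∧ (⋃ i, P i) = A ∧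
    (∀ i, v i ∈ G) ∧ Pairwise (Function.onFun Disjoint fun i => v i +ᵥ P i) ∧
    (⋃ i, v i +ᵥ P i) = B

namespace StrictlyEquidecomposable

lemma symm (h : StrictlyEquidecomposable G A B) : StrictlyEquidecomposable G B A := by
  obtain ⟨ι, _, P, v, hP, hdisj, hA, hv, hdisj', hB⟩ := h
  refine ⟨ι, ‹_›, fun i => v i +ᵥ P i, fun i => -v i, fun i => (hP i).vadd _, hdisj', hB,
    fun i => neg_mem (hv i), ?_, ?_⟩ <;> simpa only [neg_vadd_vadd]

lemma union (h : StrictlyEquidecomposable G A B) (h' : StrictlyEquidecomposable G A' B')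
    (hA : Disjoint A A') (hB : Disjoint B B') :
    StrictlyEquidecomposable G (A ∪ A') (B ∪ B') := by
  obtain ⟨ι, _, P, v, hP, hdisj, rfl, hv, hdisj', rfl⟩ := h
  obtain ⟨κ, _, Q, w, hQ, hdisjQ, rfl, hw, hdisjQ', rfl⟩ := h'
  simp only [disjoint_iUnion_left, disjoint_iUnion_right] at hA hB
  refine ⟨ι ⊕ κ, inferInstance, Sum.elim P Q, Sum.elim v w, Sum.forall.2 ⟨hP, hQ⟩, ?_,
    by simp [iUnion_sum], Sum.forall.2 ⟨hv, hw⟩, ?_, by simp [iUnion_sum]⟩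
  · rintro (i | i) (j | j) hij
    exacts [hdisj (by simpa using hij), hA j i, (hA i j).symm, hdisjQ (by simpa using hij)]
  · rintro (i | i) (j | j) hij
    exacts [hdisj' (by simpa using hij), hB j i, (hB i j).symm, hdisjQ' (by simpa using hij)]

lemma riemannMeasurable_left (h : StrictlyEquidecomposable G A B) : RiemannMeasurable A := by
  obtain ⟨ι, _, P, v, hP, -, rfl, -⟩ := h
  exact .iUnion hP

lemma volume_eq (h : StrictlyEquidecomposable G A B) : volume A = volume B := by
  obtain ⟨ι, _, P, v, hP, hdisj, rfl, -, hdisj', rfl⟩ := h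
  rw [measure_iUnion₀ (hdisj.mono fun _ _ => Disjoint.aedisjoint)
    fun i => (hP i).nullMeasurableSet, measure_iUnion₀ (hdisj'.mono fun _ _ => Disjoint.aedisjoint)
    fun i => ((hP i).vadd _).nullMeasurableSet]
  simp only [measure_vadd]

lemma equidecomposableByTranslations (h : StrictlyEquidecomposable G A B) :
    EquidecomposableByTranslations G A B := by
  obtain ⟨ι, _, P, v, hP, hdisj, hA, hv, hdisj', hB⟩ := h
  let e := (Finite.equivFin ι).symm
  exact ⟨Nat.card ι, P ∘ e, v ∘ e, fun i => hP _, fun i j hij => hdisj (e.injective.ne hij),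
    hA ▸ e.surjective.iUnion_comp P, fun i => hv _,
    fun i j hij => (hdisj' (e.injective.ne hij)).aedisjoint,
    hB ▸ (e.surjective.iUnion_comp fun i => v i +ᵥ P i).eventuallyEq⟩

end StrictlyEquidecomposable

open BoxIntegral

/-- The cell with index `ν` of the partition of `ℝᵈ` into half-open cubes of side `1 / n`: this is
`BoxIntegral.unitPartition.box` moved from `Fin d → ℝ` to the Euclidean space. -/
def gridCell (n : ℕ) [NeZero n] (ν : Fin d → ℤ) : Set (EuclideanSpace ℝ (Fin d)) :=
  WithLp.ofLp ⁻¹' (unitPartition.box n ν : Set (Fin d → ℝ))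

section GridCell

variable {n : ℕ} [NeZero n] {ν : Fin d → ℤ}

lemma mem_gridCell_iff {x : EuclideanSpace ℝ (Fin d)} :
    x ∈ gridCell n ν ↔ ∀ i, ν i / n < x i ∧ x i ≤ (ν i + 1) / n :=
  unitPartition.mem_box_iff

lemma mem_gridCell_index (n : ℕ) [NeZero n] (x : EuclideanSpace ℝ (Fin d)) :
    x ∈ gridCell n (unitPartition.index n x.ofLp) :=
  unitPartition.mem_box_iff_index.2 rfl

lemma measurableSet_gridCell : MeasurableSet (gridCell n ν) :=
  (PiLp.volume_preserving_ofLp (Fin d)).measurable (Box.measurableSet_coe _)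

lemma volume_gridCell : volume (gridCell n ν) = ((n : ℝ≥0∞) ^ d)⁻¹ := by
  rw [gridCell, (PiLp.volume_preserving_ofLp (Fin d)).measure_preimage
    (Box.measurableSet_coe _).nullMeasurableSet, unitPartition.volume_box, Fintype.card_fin,
    one_div]

lemma convex_gridCell : Convex ℝ (gridCell n ν) := by
  rw [gridCell, Box.coe_eq_pi]
  exact (convex_pi fun i _ => convex_Ioc _ _).linear_preimage
    (WithLp.linearEquiv 2 ℝ (Fin d → ℝ)).toLinearMap

lemma pairwise_disjoint_gridCell :
    Pairwise (Function.onFun Disjoint (gridCell (d := d) n)) := fun _ _ h =>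
  (unitPartition.disjoint.1 h).preimage _

lemma dist_le_of_mem_gridCell {x y : EuclideanSpace ℝ (Fin d)} (hx : x ∈ gridCell n ν)
    (hy : y ∈ gridCell n ν) : dist x y ≤ √d / n := by
  rw [mem_gridCell_iff] at hx hy
  have coord_dist_le (i : Fin d) : dist (x i) (y i) ≤ 1 / n := by
    have hx := hx i
    have hy := hy i
    rw [add_div] at hx hy
    exact abs_le.2 ⟨by linarith, by linarith⟩
  calc dist x y = √(∑ i, dist (x i) (y i) ^ 2) := EuclideanSpace.dist_eq x y
    _ ≤ √(∑ _i : Fin d, (1 / n : ℝ) ^ 2) := by gcongr; exact coord_dist_le _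
    _ = √d / n := by simp [div_eq_mul_inv]

/-- The indices of the grid cells of side `1 / n` which meet `A`. -/
def cellsMeeting (n : ℕ) [NeZero n] (A : Set (EuclideanSpace ℝ (Fin d))) : Set (Fin d → ℤ) :=
  {ν | (A ∩ gridCell n ν).Nonempty}

lemma subset_biUnion_cellsMeeting : A ⊆ ⋃ ν ∈ cellsMeeting n A, gridCell n ν := fun x hx =>
  mem_iUnion₂.2 ⟨_, ⟨x, hx, mem_gridCell_index n x⟩, mem_gridCell_index n x⟩

lemma gridCell_subset_cthickening {δ : ℝ} (hδ : √d / n ≤ δ) (hν : ν ∈ cellsMeeting n A) :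
    gridCell n ν ⊆ Metric.cthickening δ A := by
  obtain ⟨y, hyA, hy⟩ := hν
  exact fun x hx => Metric.mem_cthickening_of_dist_le x y δ A hyA
    ((dist_le_of_mem_gridCell hx hy).trans hδ)

lemma volume_biUnion_gridCell (s : Set (Fin d → ℤ)) :
    volume (⋃ ν ∈ s, gridCell n ν) = s.encard * ((n : ℝ≥0∞) ^ d)⁻¹ := by
  rw [measure_biUnion s.to_countable (pairwise_disjoint_gridCell.set_pairwise s)
    fun _ _ => measurableSet_gridCell]
  simp only [volume_gridCell, ENNReal.tsum_set_const]

end GridCell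

lemma eventually_sqrt_div_le {δ : ℝ} (hδ : 0 < δ) : ∀ᶠ n : ℕ in atTop, √d / n ≤ δ :=
  (tendsto_const_div_atTop_nhds_zero_nat _).eventually_le_const hδ

lemma eventually_gridCell_subset (hK : IsCompact K) (hV : IsOpen V) (hKV : K ⊆ V) :
    ∀ᶠ n : ℕ in atTop, ∀ [NeZero n], ∀ ν ∈ cellsMeeting n K, gridCell n ν ⊆ V := by
  obtain ⟨δ, hδ, hδV⟩ := hK.exists_cthickening_subset_open hV hKV
  filter_upwards [eventually_sqrt_div_le hδ] with n hn _ ν hν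
  exact (gridCell_subset_cthickening hn hν).trans hδV

lemma eventually_encard_cellsMeeting_lt (hK : IsCompact K) {m : ℝ≥0∞} (hm : volume K < m) :
    ∀ᶠ n : ℕ in atTop, ∀ [NeZero n], ((cellsMeeting n K).encard : ℝ≥0∞) < m * n ^ d := by
  obtain ⟨δ, hKδ, hδ⟩ : ∃ δ, volume (Metric.cthickening δ K) < m ∧ 0 < δ :=
    ((((tendsto_measure_cthickening_of_isCompact (μ := volume) hK).eventually_lt_const
      hm).filter_mono nhdsWithin_le_nhds).and self_mem_nhdsWithin).exists
      (f := nhdsWithin 0 (Ioi 0))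
  filter_upwards [eventually_sqrt_div_le hδ] with n hn _
  have hn0 : (n : ℝ≥0∞) ^ d ≠ 0 := pow_ne_zero _ (NeZero.ne _)
  rw [← ENNReal.div_lt_iff (.inl hn0) (.inl (by finiteness)), div_eq_mul_inv,
    ← volume_biUnion_gridCell]
  exact (measure_mono (iUnion₂_subset fun ν => gridCell_subset_cthickening hn)).trans_lt hKδ

lemma volume_mul_pow_le_encard_cellsMeeting (n : ℕ) [NeZero n]
    (A : Set (EuclideanSpace ℝ (Fin d))) :
    volume A * n ^ d ≤ (cellsMeeting n A).encard := by
  have hn0 : (n : ℝ≥0∞) ^ d ≠ 0 := pow_ne_zero _ (NeZero.ne _)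
  rw [← ENNReal.le_div_iff_mul_le (.inl hn0) (.inl (by finiteness)), div_eq_mul_inv,
    ← volume_biUnion_gridCell]
  exact measure_mono subset_biUnion_cellsMeeting

lemma eventually_mul_succ_pow_le {a b : ℝ≥0∞} (hab : a < b) (k : ℕ) :
    ∀ᶠ n : ℕ in atTop, a * (n + 1 : ℕ) ^ k ≤ b * n ^ k := by
  have ratio_tendsto : Tendsto (fun n : ℕ => a * ENNReal.ofReal ((1 + 1 / n) ^ k)) atTop
      (nhds a) := by
    have := (((tendsto_const_div_atTop_nhds_zero_nat (1 : ℝ)).const_add 1).pow k)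
    simpa using ENNReal.Tendsto.const_mul (ENNReal.tendsto_ofReal this) (.inr hab.ne_top)
  filter_upwards [ratio_tendsto.eventually_le_const hab, eventually_gt_atTop 0] with n hn hn0
  have succ_eq : ((n + 1 : ℕ) : ℝ≥0∞) ^ k = ENNReal.ofReal ((1 + 1 / n) ^ k) * n ^ k := by
    rw [← ENNReal.ofReal_natCast n, ← ENNReal.ofReal_natCast, ← ENNReal.ofReal_pow (by positivity),
      ← ENNReal.ofReal_pow (by positivity), ← ENNReal.ofReal_mul (by positivity), ← mul_pow,
      add_mul, one_mul, one_div_mul_cancel (by positivity), Nat.cast_succ]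
  calc a * (n + 1 : ℕ) ^ k = a * ENNReal.ofReal ((1 + 1 / n) ^ k) * n ^ k := by
        rw [succ_eq, mul_assoc]
    _ ≤ b * n ^ k := by gcongr

lemma eventually_encard_cellsMeeting_succ_le (hA : IsCompact A) (hAB : volume A < volume B) :
    ∀ᶠ n : ℕ in atTop, ∀ [NeZero n], (cellsMeeting (n + 1) A).Finite ∧
      (cellsMeeting (n + 1) A).encard ≤ (cellsMeeting n B).encard := by
  obtain ⟨m, hAm, hmB⟩ := exists_between hAB
  filter_upwards [(tendsto_add_atTop_nat 1).eventually (eventually_encard_cellsMeeting_lt hA hAm),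
    eventually_mul_succ_pow_le hmB d] with n hn hratio _
  refine ⟨encard_ne_top_iff.1 fun h => ?_, ENat.toENNReal_le.1 ?_⟩
  · simpa [h] using hn
  · calc ((cellsMeeting (n + 1) A).encard : ℝ≥0∞) ≤ m * (n + 1 : ℕ) ^ d := hn.le
      _ ≤ volume B * n ^ d := hratio
      _ ≤ (cellsMeeting n B).encard := volume_mul_pow_le_encard_cellsMeeting n B

lemma exists_vadd_gridCell_succ_subset {G : Set (EuclideanSpace ℝ (Fin d))} (hG : Dense G)
    (n : ℕ) [NeZero n] (μ ν : Fin d → ℤ) : ∃ g ∈ G, g +ᵥ gridCell (n + 1) μ ⊆ gridCell n ν := by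
  have hn : (0 : ℝ) < n := Nat.cast_pos.2 (Nat.pos_of_neZero n)
  have side_lt : (1 : ℝ) / (n + 1 : ℕ) < 1 / n := by
    gcongr
    exact_mod_cast n.lt_succ_self
  let slack : ℝ := (1 / n - 1 / (n + 1 : ℕ)) / 2
  obtain ⟨g, hg, hdist⟩ := hG.exists_dist_lt
    (WithLp.toLp 2 fun i => ν i / n - μ i / (n + 1 : ℕ) + slack) (ε := slack) (by
      simp only [slack]; linarith)
  refine ⟨g, hg, ?_⟩
  rintro _ ⟨x, hx, rfl⟩
  rw [mem_gridCell_iff] at hx ⊢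
  intro i
  have hgi : |ν i / n - μ i / (n + 1 : ℕ) + slack - g i| < slack :=
    (PiLp.norm_apply_le (WithLp.toLp 2 (fun i => ν i / n - μ i / (n + 1 : ℕ) + slack) - g)
      i).trans_lt (by rwa [← dist_eq_norm])
  have hxi := hx i
  rw [abs_lt] at hgi
  rw [add_div] at hxi ⊢
  simp only [slack, vadd_eq_add, PiLp.add_apply] at hgi ⊢
  constructor <;> linarith

theorem exists_subset_strictlyEquidecomposable
    (hG : Dense (G : Set (EuclideanSpace ℝ (Fin d)))) (hA : RiemannMeasurable A) (hV : IsOpen V)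
    (hAV : volume A < volume V) : ∃ A' ⊆ V, StrictlyEquidecomposable G A A' := by
  obtain ⟨C, hCV, hC, hAC⟩ := hV.exists_lt_isCompact hAV
  rw [← measure_closure_of_null_frontier hA.2] at hAC
  obtain ⟨n, ⟨hcount, hcellV⟩, hn⟩ := (((eventually_encard_cellsMeeting_succ_le
    hA.1.isCompact_closure hAC).and (eventually_gridCell_subset hC hV hCV)).and
    (eventually_gt_atTop 0)).exists
  have : NeZero n := ⟨hn.ne'⟩
  obtain ⟨hfin, hle⟩ := hcount
  obtain ⟨f, hfC, hf⟩ := hfin.exists_injOn_of_encard_le hle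
  choose g hgG hg using fun ν => exists_vadd_gridCell_succ_subset hG n ν (f ν)
  let P (ν : cellsMeeting (n + 1) (closure A)) := A ∩ gridCell (n + 1) ν.1
  have image_subset (ν) : g ν.1 +ᵥ P ν ⊆ gridCell n (f ν) :=
    (vadd_set_mono inter_subset_right).trans (hg _)
  have iUnion_P : ⋃ ν, P ν = A := by
    rw [← inter_iUnion, inter_eq_left, ← biUnion_eq_iUnion (t := fun ν _ => gridCell (n + 1) ν)]
    exact subset_closure.trans subset_biUnion_cellsMeeting
  refine ⟨⋃ ν, g ν.1 +ᵥ P ν, iUnion_subset fun ν => (image_subset ν).trans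
    (hcellV _ (hfC ν.2)), _, ?_, P, fun ν => g ν, fun ν =>
    hA.inter_of_null_frontier (convex_gridCell.addHaar_frontier _), fun μ ν hμν => ?_, iUnion_P,
    fun ν => hgG ν, fun μ ν hμν => ?_, rfl⟩
  · exact hfin
  · exact (pairwise_disjoint_gridCell (Subtype.coe_ne_coe.2 hμν)).mono inter_subset_right
      inter_subset_right
  · exact (pairwise_disjoint_gridCell (hf.ne μ.2 ν.2 (Subtype.coe_ne_coe.2 hμν))).mono
      (image_subset μ) (image_subset ν)

lemma exists_riemannMeasurable_between (hK : IsCompact K) (hU : IsOpen U) (hKU : K ⊆ U)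
    {m : ℝ≥0∞} (hKm : volume K < m) :
    ∃ A, RiemannMeasurable A ∧ K ⊆ A ∧ closure A ⊆ U ∧ volume A < m := by
  obtain ⟨δ₁, hδ₁, hδU⟩ := hK.exists_cthickening_subset_open hU hKU
  obtain ⟨δ, hδm, hδ, hδδ₁⟩ := ((((tendsto_measure_cthickening_of_isCompact (μ := volume)
    hK).eventually_lt_const hKm).filter_mono nhdsWithin_le_nhds).and
    (Ioc_mem_nhdsGT hδ₁)).exists (f := nhdsWithin 0 (Ioi 0))
  obtain ⟨r, hr, hfrontier⟩ := exists_null_frontier_thickening volume K hδ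
  have closure_subset : closure (Metric.thickening r K) ⊆ Metric.cthickening δ K :=
    (Metric.closure_thickening_subset_cthickening r K).trans (Metric.cthickening_mono hr.2.le K)
  exact ⟨Metric.thickening r K, ⟨hK.isBounded.thickening, hfrontier⟩,
    Metric.self_subset_thickening hr.1 K,
    closure_subset.trans ((Metric.cthickening_mono hδδ₁ K).trans hδU),
    (measure_mono (subset_closure.trans closure_subset)).trans_lt hδm⟩

theorem exists_strictlyEquidecomposable_between
    (hG : Dense (G : Set (EuclideanSpace ℝ (Fin d)))) {P : Set (EuclideanSpace ℝ (Fin d))}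
    (hP : RiemannMeasurable P) (hK : IsCompact K) (hU : IsOpen U) (hKU : K ⊆ U)
    (hKP : volume K < volume P) (hPU : volume P < volume U) :
    ∃ S, K ⊆ S ∧ S ⊆ U ∧ StrictlyEquidecomposable G S P := by
  obtain ⟨A, hA, hKA, hAU, hAP⟩ := exists_riemannMeasurable_between hK hU hKU hKP
  rw [← measure_interior_of_null_frontier hP.2] at hAP
  obtain ⟨A', hA'P, hAA'⟩ :=
    exists_subset_strictlyEquidecomposable hG hA isOpen_interior hAP
  replace hA'P := hA'P.trans interior_subset
  have hA' : RiemannMeasurable A' := hAA'.symm.riemannMeasurable_left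
  have volume_diff_lt : volume (P \ A') < volume (U \ closure A) := by
    have volume_P : volume A + volume (P \ A') = volume P := by
      rw [hAA'.volume_eq, ← measure_inter_add_sdiff₀ P hA'.nullMeasurableSet,
        inter_eq_right.2 hA'P]
    have volume_U : volume A + volume (U \ closure A) = volume U := by
      rw [← measure_closure_of_null_frontier hA.2,
        ← measure_inter_add_sdiff U isClosed_closure.measurableSet, inter_eq_right.2 hAU]
    rw [← volume_P, ← volume_U] at hPU
    exact lt_of_add_lt_add_left hPU
  obtain ⟨B, hBU, hPB⟩ := exists_subset_strictlyEquidecomposable hG (hP.diff hA')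
    (hU.sdiff isClosed_closure) volume_diff_lt
  have hAB : Disjoint A B :=
    (disjoint_sdiff_right.mono_right hBU).mono_left subset_closure
  refine ⟨A ∪ B, hKA.trans subset_union_left,
    union_subset (subset_closure.trans hAU) (hBU.trans sdiff_subset), ?_⟩
  simpa only [union_sdiff_cancel hA'P] using hAA'.union hPB.symm hAB disjoint_sdiff_right

end Equidecomposability

/-! ### Volumes and dual bases in a product space -/

section ProductSpace

open Module (Basis)

variable {E F ι κ : Type*} [NormedAddCommGroup E] [InnerProductSpace ℝ E]
  [NormedAddCommGroup F] [InnerProductSpace ℝ F]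

variable (E F) in
/-- The Euclidean scalar product of `E × F`, as a bilinear form: `E × F` itself carries the supremum
norm, and so is not an inner product space. -/
noncomputable def prodForm : LinearMap.BilinForm ℝ (E × F) :=
  (innerₗ E).compl₁₂ (LinearMap.fst ℝ E F) (LinearMap.fst ℝ E F) +
    (innerₗ F).compl₁₂ (LinearMap.snd ℝ E F) (LinearMap.snd ℝ E F)

lemma prodForm_apply (x y : E × F) : prodForm E F x y = ⟪x.1, y.1⟫ + ⟪x.2, y.2⟫ := rfl

lemma prodForm_isSymm : (prodForm E F).IsSymm :=
  ⟨fun x y => by simp only [prodForm_apply, real_inner_comm]⟩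

lemma prodForm_nondegenerate : (prodForm E F).Nondegenerate := by
  have isRefl := (prodForm_isSymm (E := E) (F := F)).isRefl
  refine (LinearMap.IsRefl.nondegenerate_iff_separatingLeft isRefl).2 fun x hx => ?_
  have sum_sq : ‖x.1‖ ^ 2 + ‖x.2‖ ^ 2 = 0 := by
    simpa only [prodForm_apply, real_inner_self_eq_norm_sq] using hx x
  rw [add_eq_zero_iff_of_nonneg (by positivity) (by positivity)] at sum_sq
  exact Prod.ext (by simpa using sum_sq.1) (by simpa using sum_sq.2)

lemma fundamentalDomain_prod (b : Basis ι ℝ E) (c : Basis κ ℝ F) :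
    ZSpan.fundamentalDomain (b.prod c) =
      ZSpan.fundamentalDomain b ×ˢ ZSpan.fundamentalDomain c := by
  ext x
  simp [ZSpan.mem_fundamentalDomain]

variable [Fintype ι] [Fintype κ]

lemma transpose_toMatrix_mul_toMatrix_prod (b : OrthonormalBasis ι ℝ E)
    (c : OrthonormalBasis κ ℝ F) {m n : Type*} (x : m → E × F) (y : n → E × F) :
    ((b.toBasis.prod c.toBasis).toMatrix x).transpose * (b.toBasis.prod c.toBasis).toMatrix y =
      Matrix.of fun i j => prodForm E F (x i) (y j) := by
  ext i j
  simp only [Matrix.mul_apply, Matrix.transpose_apply, Basis.toMatrix_apply, Matrix.of_apply,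
    Fintype.sum_sum_type, Basis.prod_repr_inl, Basis.prod_repr_inr,
    OrthonormalBasis.coe_toBasis_repr_apply, OrthonormalBasis.repr_apply_apply, prodForm_apply]
  rw [← b.sum_inner_mul_inner, ← c.sum_inner_mul_inner]
  simp only [real_inner_comm]

/-- Jacobi's identity between complementary minors of a matrix and of its inverse transpose. -/
lemma det_mul_det_fst_dualBasis [DecidableEq ι] [DecidableEq κ]
    (b : OrthonormalBasis ι ℝ E) (c : OrthonormalBasis κ ℝ F) (e : Basis (ι ⊕ κ) ℝ (E × F)) :
    (b.toBasis.prod c.toBasis).det e * b.toBasis.det (fun i =>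
      ((prodForm E F).dualBasis prodForm_nondegenerate e (.inl i)).1) =
      c.toBasis.det fun k => (e (.inr k)).2 := by
  let w : ι ⊕ κ → E × F :=
    Sum.elim (fun i => (prodForm E F).dualBasis prodForm_nondegenerate e (.inl i))
      (fun k => (0, c k))
  have det_w : ((b.toBasis.prod c.toBasis).toMatrix w).det =
      b.toBasis.det fun i => (w (.inl i)).1 := by
    have toMatrix_w : (b.toBasis.prod c.toBasis).toMatrix w =
        Matrix.fromBlocks (b.toBasis.toMatrix fun i => (w (.inl i)).1) 0
          (c.toBasis.toMatrix fun i => (w (.inl i)).2) 1 := by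
      ext (i | i) (j | j) <;> simp [w, Basis.toMatrix_apply, Matrix.one_apply]
    rw [toMatrix_w, Matrix.det_fromBlocks_zero₁₂, Matrix.det_one, mul_one, Basis.det_apply]
  have gram : ((b.toBasis.prod c.toBasis).toMatrix e).transpose *
      (b.toBasis.prod c.toBasis).toMatrix w = Matrix.fromBlocks 1
        (Matrix.of fun i k => ⟪(e (.inl i)).2, c k⟫) 0
        (c.toBasis.toMatrix fun k => (e (.inr k)).2).transpose := by
    rw [transpose_toMatrix_mul_toMatrix_prod]
    ext (i | i) (j | j)
    · simp [w, LinearMap.BilinForm.apply_dualBasis_right (B := prodForm E F) _ prodForm_isSymm,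
        Matrix.one_apply]
    · simp [w, prodForm_apply]
    · simp [w, LinearMap.BilinForm.apply_dualBasis_right (B := prodForm E F) _ prodForm_isSymm]
    · simp [w, prodForm_apply, Basis.toMatrix_apply, real_inner_comm, c.repr_apply_apply]
  have det_gram := congrArg Matrix.det gram
  rwa [Matrix.det_mul, Matrix.det_transpose, Matrix.det_fromBlocks_zero₂₁, Matrix.det_one,
    one_mul, Matrix.det_transpose, det_w] at det_gram

variable [FiniteDimensional ℝ E] [MeasurableSpace E] [BorelSpace E]
  [FiniteDimensional ℝ F] [MeasurableSpace F] [BorelSpace F]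

lemma volume_fundamentalDomain_orthonormalBasis (b : OrthonormalBasis ι ℝ E) :
    volume (ZSpan.fundamentalDomain b.toBasis) = 1 := by
  rw [measure_congr (ZSpan.fundamentalDomain_ae_parallelepiped b.toBasis volume),
    b.coe_toBasis, b.volume_parallelepiped]

lemma volume_parallelepiped_eq_det [DecidableEq ι] (b : OrthonormalBasis ι ℝ E) (v : ι → E) :
    volume (parallelepiped v) = ENNReal.ofReal |b.toBasis.det v| := by
  rw [← b.addHaar_eq_volume, Measure.addHaar_parallelepiped]

instance : (volume : Measure (E × F)).IsAddHaarMeasure :=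
  inferInstanceAs ((volume : Measure E).prod (volume : Measure F)).IsAddHaarMeasure

lemma covolume_eq_abs_det [DecidableEq ι] [DecidableEq κ]
    (b : OrthonormalBasis ι ℝ E) (c : OrthonormalBasis κ ℝ F)
    (Γ : Submodule ℤ (E × F)) [DiscreteTopology Γ] [IsZLattice ℝ Γ] (e : Basis (ι ⊕ κ) ℤ Γ) :
    ZLattice.covolume Γ = |(b.toBasis.prod c.toBasis).det (e.ofZLatticeBasis ℝ Γ)| := by
  have coe_e : (fun i => (e i : E × F)) = e.ofZLatticeBasis ℝ Γ :=
    funext fun i => (e.ofZLatticeBasis_apply ℝ Γ i).symm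
  rw [ZLattice.covolume_eq_det_mul_measureReal Γ volume e (b.toBasis.prod c.toBasis),
    fundamentalDomain_prod, Measure.volume_eq_prod, measureReal_prod_prod, measureReal_def,
    measureReal_def, volume_fundamentalDomain_orthonormalBasis,
    volume_fundamentalDomain_orthonormalBasis, ← coe_e]
  simp [Function.comp_def]

end ProductSpace

lemma exists_basis_smul_apply_eq {R M ι : Type*} [CommRing R] [IsDomain R] [IsPrincipalIdealRing R]
    [AddCommGroup M] [Module R M] [Finite ι] (b : Module.Basis ι R M) (x : M) (i : ι) :
    ∃ (b' : Module.Basis ι R M) (a : R), a • b' i = x := by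
  classical
  by_cases hx : x = 0
  · exact ⟨b, 0, by rw [zero_smul, hx]⟩
  obtain ⟨n, bM, bN, f, a, snf⟩ := Submodule.smithNormalForm b (Submodule.span R {x})
  have : Module.IsTorsionFree R M := b.isTorsionFree
  have rank_span : n = 1 := by
    have h := (LinearEquiv.toSpanNonzeroSingleton R M x hx).finrank_eq
    rw [Module.finrank_eq_card_basis bN] at h
    simpa using h.symm
  subst rank_span
  have hxN := congrArg Subtype.val (bN.sum_repr ⟨x, Submodule.mem_span_singleton_self x⟩)
  simp only [Fin.sum_univ_one, Submodule.coe_smul, snf, smul_smul] at hxN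
  exact ⟨bM.reindex (Equiv.swap (f 0) i), _, by simpa using hxN⟩

section DualLattice

open Module (Basis)

variable {d : ℕ} {Γ : Submodule ℤ (EuclideanSpace ℝ (Fin d) × ℝ)}

lemma mem_dualLattice_iff {y : EuclideanSpace ℝ (Fin d) × ℝ} :
    y ∈ dualLattice Γ ↔ y ∈ (prodForm (EuclideanSpace ℝ (Fin d)) ℝ).dualSubmodule Γ := by
  rw [LinearMap.BilinForm.mem_dualSubmodule]
  refine forall₂_congr fun _ _ => ?_
  simp [prodForm_apply, Submodule.mem_one, real_inner_comm, eq_comm]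

variable [DiscreteTopology Γ] [IsZLattice ℝ Γ]

lemma dualBasis_mem_dualLattice {ι : Type*} [Finite ι] [DecidableEq ι] (e : Basis ι ℤ Γ) (i : ι) :
    (prodForm (EuclideanSpace ℝ (Fin d)) ℝ).dualBasis prodForm_nondegenerate
      (e.ofZLatticeBasis ℝ Γ) i ∈ dualLattice Γ := by
  have dual_eq := LinearMap.BilinForm.dualSubmodule_span_of_basis (R := ℤ)
    (B := prodForm (EuclideanSpace ℝ (Fin d)) ℝ) prodForm_nondegenerate (e.ofZLatticeBasis ℝ Γ)
  rw [e.ofZLatticeBasis_span ℝ] at dual_eq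
  rw [mem_dualLattice_iff, dual_eq]
  exact Submodule.subset_span (mem_range_self i)

lemma mem_of_forall_mem_dualLattice {x : EuclideanSpace ℝ (Fin d) × ℝ}
    (hx : ∀ y ∈ dualLattice Γ, ∃ n : ℤ, ⟪x.1, y.1⟫ + x.2 * y.2 = n) : x ∈ Γ := by
  let e := Module.Free.chooseBasis ℤ Γ
  have bidual_eq := LinearMap.BilinForm.dualSubmodule_dualSubmodule_of_basis (R := ℤ)
    (B := prodForm (EuclideanSpace ℝ (Fin d)) ℝ) prodForm_nondegenerate prodForm_isSymm
    (e.ofZLatticeBasis ℝ Γ)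
  rw [e.ofZLatticeBasis_span ℝ] at bidual_eq
  rw [← bidual_eq, LinearMap.BilinForm.mem_dualSubmodule]
  intro y hy
  obtain ⟨n, hn⟩ := hx y (mem_dualLattice_iff.2 hy)
  refine Submodule.mem_one.2 ⟨n, ?_⟩
  simp [prodForm_apply, ← hn, mul_comm]

lemma nonempty_basis_fin_sum_unit : Nonempty (Basis (Fin d ⊕ Unit) ℤ Γ) := by
  have finrank_eq : Module.finrank ℤ Γ = d + 1 := by simp [ZLattice.rank ℝ Γ]
  exact ⟨(Module.finBasisOfFinrankEq ℤ Γ finrank_eq).reindex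
    (Fintype.equivOfCardEq (by simp))⟩

lemma abs_det_fst_dualBasis_mul_covolume (e : Basis (Fin d ⊕ Unit) ℤ Γ) :
    |(EuclideanSpace.basisFun (Fin d) ℝ).toBasis.det fun i =>
      ((prodForm (EuclideanSpace ℝ (Fin d)) ℝ).dualBasis prodForm_nondegenerate
        (e.ofZLatticeBasis ℝ Γ) (.inl i)).1| * ZLattice.covolume Γ =
      |(e (.inr ()) : EuclideanSpace ℝ (Fin d) × ℝ).2| := by
  rw [covolume_eq_abs_det (EuclideanSpace.basisFun (Fin d) ℝ) (OrthonormalBasis.singleton Unit ℝ),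
    ← abs_mul, mul_comm, det_mul_det_fst_dualBasis]
  simp [Basis.det_apply, Basis.toMatrix_apply, Matrix.det_unique]

theorem exists_dual_parallelepiped (hd : d ≠ 0) {γ : EuclideanSpace ℝ (Fin d) × ℝ} (hγ : γ ∈ Γ)
    (hpos : 0 < γ.2) : ∃ v : Fin d → EuclideanSpace ℝ (Fin d), (∀ i, v i ∈ dualProj Γ) ∧
      LinearIndependent ℝ v ∧
      volume (parallelepiped v) = ENNReal.ofReal (γ.2 / ZLattice.covolume Γ) := by
  obtain ⟨b⟩ := nonempty_basis_fin_sum_unit (Γ := Γ)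
  obtain ⟨e, n, hn⟩ := exists_basis_smul_apply_eq b ⟨γ, hγ⟩ (.inr ())
  let u : Fin d → EuclideanSpace ℝ (Fin d) := fun i =>
    ((prodForm _ ℝ).dualBasis prodForm_nondegenerate (e.ofZLatticeBasis ℝ Γ) (.inl i)).1
  have hu (i) : u i ∈ dualProj Γ := ⟨_, dualBasis_mem_dualLattice e (.inl i), rfl⟩
  let k : Fin d := ⟨0, Nat.pos_of_ne_zero hd⟩
  let v := Function.update u k ((n : ℝ) • u k)
  have abs_det_v : |(EuclideanSpace.basisFun (Fin d) ℝ).toBasis.det v| =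
      γ.2 / ZLattice.covolume Γ := by
    have snd_eq : γ.2 = n * (e (.inr ()) : EuclideanSpace ℝ (Fin d) × ℝ).2 := by
      simpa using (congrArg (fun x : Γ => (x : EuclideanSpace ℝ (Fin d) × ℝ).2) hn).symm
    rw [AlternatingMap.map_update_smul, Function.update_eq_self, smul_eq_mul, abs_mul,
      eq_div_iff (ZLattice.covolume_pos Γ volume).ne', mul_assoc,
      abs_det_fst_dualBasis_mul_covolume, ← abs_mul, ← snd_eq, abs_of_pos hpos]
  refine ⟨v, ?_, ?_, by
    rw [volume_parallelepiped_eq_det (EuclideanSpace.basisFun (Fin d) ℝ), abs_det_v]⟩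
  · refine Function.forall_update_iff u (fun _ x => x ∈ dualProj Γ) |>.2 ⟨?_, fun _ _ => hu _⟩
    rw [Int.cast_smul_eq_zsmul]
    exact zsmul_mem (hu k) n
  · have det_ne_zero : (EuclideanSpace.basisFun (Fin d) ℝ).toBasis.det v ≠ 0 := by
      rw [← abs_pos, abs_det_v]
      exact div_pos hpos (ZLattice.covolume_pos Γ volume)
    exact ((Basis.is_basis_iff_det _).2 det_ne_zero.isUnit).1

end DualLattice

/-! ### Closed subgroups and Kronecker's theorem -/

section Lineality

open Topology

variable {E : Type*} [NormedAddCommGroup E] [NormedSpace ℝ E]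

/-- The largest real subspace contained in an additive subgroup. -/
def linealitySpace (H : AddSubgroup E) : Submodule ℝ E where
  carrier := {v | ∀ t : ℝ, t • v ∈ H}
  zero_mem' t := by simp
  add_mem' hv hw t := by rw [smul_add]; exact add_mem (hv t) (hw t)
  smul_mem' c v hv t := by rw [smul_smul]; exact hv _

lemma mem_of_mem_linealitySpace {H : AddSubgroup E} {v : E} (hv : v ∈ linealitySpace H) :
    v ∈ H := by
  simpa using hv 1

lemma tendsto_floor_div_mul (t : ℝ) :
    Tendsto (fun x : ℝ => ⌊t / x⌋ * x) (𝓝[>] 0) (𝓝 t) := by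
  have lower_tendsto : Tendsto (fun x : ℝ => t - x) (𝓝[>] 0) (𝓝 t) := by
    simpa using (tendsto_id.mono_left (nhdsWithin_le_nhds (a := (0 : ℝ)))).const_sub t
  refine tendsto_of_tendsto_of_tendsto_of_le_of_le' lower_tendsto tendsto_const_nhds ?_ ?_
  · filter_upwards [self_mem_nhdsWithin] with x (hx : 0 < x)
    linarith [(div_lt_iff₀ hx).1 (Int.lt_floor_add_one (t / x))]
  · filter_upwards [self_mem_nhdsWithin] with x (hx : 0 < x)
    exact (le_div_iff₀ hx).1 (Int.floor_le _)

lemma mem_linealitySpace_of_tendsto {ι : Type*} {l : Filter ι} [l.NeBot] {H : AddSubgroup E}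
    (hH : IsClosed (H : Set E)) {h : ι → E} {v : E} (h_mem : ∀ i, h i ∈ H)
    (h_norm : Tendsto (fun i => ‖h i‖) l (𝓝[>] 0))
    (h_dir : Tendsto (fun i => ‖h i‖⁻¹ • h i) l (𝓝 v)) : v ∈ linealitySpace H := by
  intro t
  refine hH.mem_of_tendsto (((tendsto_floor_div_mul t).comp h_norm).smul h_dir) ?_
  filter_upwards [h_norm self_mem_nhdsWithin] with i (hi : 0 < ‖h i‖)
  have multiple : (⌊t / ‖h i‖⌋ * ‖h i‖ : ℝ) • ‖h i‖⁻¹ • h i = ⌊t / ‖h i‖⌋ • h i := by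
    rw [smul_smul, mul_assoc, mul_inv_cancel₀ hi.ne', mul_one, Int.cast_smul_eq_zsmul]
  simpa only [Function.comp_apply, multiple, SetLike.mem_coe] using zsmul_mem (h_mem i) _

end Lineality

section Kronecker

open Topology

variable {E : Type*} [NormedAddCommGroup E] [InnerProductSpace ℝ E]
  {H : AddSubgroup E}

variable (H) in
/-- The part of an additive subgroup orthogonal to its lineality space. For a closed subgroup it is
the discrete factor in the decomposition of the subgroup as a real subspace plus a lattice. -/
noncomputable def orthogonalPart : Submodule ℤ (linealitySpace H)ᗮ :=
  (H.comap (linealitySpace H)ᗮ.subtype.toAddMonoidHom).toIntSubmodule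

lemma mem_orthogonalPart {x : (linealitySpace H)ᗮ} : x ∈ orthogonalPart H ↔ (x : E) ∈ H :=
  Iff.rfl

variable [FiniteDimensional ℝ E]

lemma exists_pos_forall_norm_lt_eq_zero (hH : IsClosed (H : Set E)) :
    ∃ ε > 0, ∀ h ∈ H, h ∈ (linealitySpace H)ᗮ → ‖h‖ < ε → h = 0 := by
  by_contra! exists_small
  choose h h_mem h_orth h_lt h_ne using fun n : ℕ =>
    exists_small (1 / ((n : ℝ) + 1)) Nat.one_div_pos_of_nat
  have h_pos (n : ℕ) : 0 < ‖h n‖ := norm_pos_iff.2 (h_ne n)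
  have h_norm : Tendsto (fun n => ‖h n‖) atTop (𝓝[>] 0) :=
    tendsto_nhdsWithin_iff.2 ⟨squeeze_zero (fun n => norm_nonneg _) (fun n => (h_lt n).le)
      tendsto_one_div_add_atTop_nhds_zero_nat, Eventually.of_forall h_pos⟩
  obtain ⟨v, hv, φ, φ_mono, h_dir⟩ := (isCompact_sphere (0 : E) 1).tendsto_subseq
    (x := fun n => ‖h n‖⁻¹ • h n) fun n => by simp [norm_smul, (h_pos n).ne']
  have v_orth : v ∈ (linealitySpace H)ᗮ :=
    (Submodule.isClosed_orthogonal _).mem_of_tendsto h_dir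
      (Eventually.of_forall fun n => Submodule.smul_mem _ _ (h_orth _))
  have v_lineal : v ∈ linealitySpace H :=
    mem_linealitySpace_of_tendsto hH (fun n => h_mem (φ n)) (h_norm.comp φ_mono.tendsto_atTop) h_dir
  have v_zero : v = 0 :=
    Submodule.disjoint_def.1 (Submodule.orthogonal_disjoint (linealitySpace H)) v v_lineal v_orth
  simp [v_zero] at hv

lemma orthogonalProjectionOnto_mem_orthogonalPart {h : E} (hh : h ∈ H) :
    (linealitySpace H)ᗮ.orthogonalProjectionOnto h ∈ orthogonalPart H := by
  have sub_eq : ((linealitySpace H)ᗮ.orthogonalProjectionOnto h : E) =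
      h - (linealitySpace H).starProjection h := by
    rw [eq_sub_iff_add_eq']
    exact (linealitySpace H).starProjection_add_starProjection_orthogonal h
  rw [mem_orthogonalPart, sub_eq]
  exact sub_mem hh (mem_of_mem_linealitySpace (Submodule.starProjection_apply_mem _ h))

lemma discreteTopology_orthogonalPart (hH : IsClosed (H : Set E)) :
    DiscreteTopology (orthogonalPart H) := by
  obtain ⟨ε, ε_pos, small_eq_zero⟩ := exists_pos_forall_norm_lt_eq_zero hH
  refine discreteTopology_of_isOpen_singleton_zero (Metric.isOpen_singleton_iff.2
    ⟨ε, ε_pos, fun y hy => Subtype.ext (Subtype.ext ?_)⟩)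
  exact small_eq_zero _ (mem_orthogonalPart.1 y.2) (y : (linealitySpace H)ᗮ).2 (by simpa using hy)

lemma span_orthogonalPart_eq_top (hspan : Submodule.span ℝ (H : Set E) = ⊤) :
    Submodule.span ℝ (orthogonalPart H : Set (linealitySpace H)ᗮ) = ⊤ := by
  have map_eq : (Submodule.span ℝ (H : Set E)).map
      ((linealitySpace H)ᗮ.orthogonalProjectionOnto : E →L[ℝ] _).toLinearMap = ⊤ := by
    rw [hspan, Submodule.map_top, LinearMap.range_eq_top]
    exact fun x => ⟨x, by simp⟩
  rw [eq_top_iff, ← map_eq, Submodule.map_span, Submodule.span_le]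
  rintro _ ⟨h, hh, rfl⟩
  exact Submodule.subset_span (orthogonalProjectionOnto_mem_orthogonalPart hh)

lemma exists_ne_zero_forall_mem_lattice_inner_eq_intCast [Nontrivial E] (L : Submodule ℤ E)
    [DiscreteTopology L] [IsZLattice ℝ L] :
    ∃ u : E, u ≠ 0 ∧ ∀ x ∈ L, ∃ n : ℤ, ⟪u, x⟫ = n := by
  let b := Module.Free.chooseBasis ℤ L
  obtain ⟨i⟩ := (b.ofZLatticeBasis ℝ L).index_nonempty
  let u := (InnerProductSpace.toDual ℝ E).symm
    ((b.ofZLatticeBasis ℝ L).coord i).toContinuousLinearMap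
  have inner_u (x : E) : ⟪u, x⟫ = (b.ofZLatticeBasis ℝ L).repr x i :=
    InnerProductSpace.toDual_symm_apply
  refine ⟨u, fun u_zero => ?_, fun x hx => ⟨b.repr ⟨x, hx⟩ i, ?_⟩⟩
  · simpa [u_zero] using inner_u (b.ofZLatticeBasis ℝ L i)
  · rw [inner_u]
    exact b.ofZLatticeBasis_repr_apply ℝ L ⟨x, hx⟩ i

lemma exists_ne_zero_forall_mem_inner_eq_intCast_of_isClosed (hH : IsClosed (H : Set E))
    (hspan : Submodule.span ℝ (H : Set E) = ⊤) (h_ne : (H : Set E) ≠ univ) :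
    ∃ u : E, u ≠ 0 ∧ ∀ h ∈ H, ∃ n : ℤ, ⟪u, h⟫ = n := by
  have lineality_ne_top : linealitySpace H ≠ ⊤ := fun h_top =>
    h_ne (eq_univ_of_forall fun x => mem_of_mem_linealitySpace (h_top ▸ Submodule.mem_top))
  have : Nontrivial (linealitySpace H)ᗮ := by
    rwa [Submodule.nontrivial_iff_ne_bot, Ne, Submodule.orthogonal_eq_bot_iff]
  have := discreteTopology_orthogonalPart hH
  have : IsZLattice ℝ (orthogonalPart H) := ⟨span_orthogonalPart_eq_top hspan⟩
  obtain ⟨u, u_ne, hu⟩ := exists_ne_zero_forall_mem_lattice_inner_eq_intCast (orthogonalPart H)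
  refine ⟨u, by simpa using u_ne, fun h hh => ?_⟩
  rw [← Submodule.inner_orthogonalProjectionOnto_eq_of_mem_left]
  exact hu _ (orthogonalProjectionOnto_mem_orthogonalPart hh)

theorem exists_ne_zero_forall_mem_inner_eq_intCast_of_not_dense (hH : ¬ Dense (H : Set E)) :
    ∃ u : E, u ≠ 0 ∧ ∀ h ∈ H, ∃ n : ℤ, ⟪u, h⟫ = n := by
  by_cases hspan : Submodule.span ℝ (H : Set E) = ⊤
  · have closure_ne : (H.topologicalClosure : Set E) ≠ univ := fun h_univ =>
      hH (dense_iff_closure_eq.2 h_univ)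
    have span_closure : Submodule.span ℝ (H.topologicalClosure : Set E) = ⊤ :=
      top_unique (hspan.ge.trans (Submodule.span_mono H.le_topologicalClosure))
    obtain ⟨u, u_ne, hu⟩ := exists_ne_zero_forall_mem_inner_eq_intCast_of_isClosed
      H.isClosed_topologicalClosure span_closure closure_ne
    exact ⟨u, u_ne, fun h hh => hu h (H.le_topologicalClosure hh)⟩
  · obtain ⟨u, u_orth, u_ne⟩ := Submodule.exists_mem_ne_zero_of_ne_bot
      (mt (Submodule.orthogonal_eq_bot_iff (K := Submodule.span ℝ (H : Set E))).1 hspan)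
    refine ⟨u, u_ne, fun h hh => ⟨0, ?_⟩⟩
    rw [Int.cast_zero]
    exact Submodule.inner_left_of_mem_orthogonal (Submodule.subset_span hh) u_orth

end Kronecker

theorem dense_dualProj {d : ℕ} {Γ : Submodule ℤ (EuclideanSpace ℝ (Fin d) × ℝ)}
    [DiscreteTopology Γ] [IsZLattice ℝ Γ]
    (hsnd : InjOn Prod.snd (Γ : Set (EuclideanSpace ℝ (Fin d) × ℝ))) :
    Dense (dualProj Γ : Set (EuclideanSpace ℝ (Fin d))) := by
  by_contra not_dense
  obtain ⟨u, u_ne, hu⟩ := exists_ne_zero_forall_mem_inner_eq_intCast_of_not_dense not_dense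
  have mem_lattice : (u, (0 : ℝ)) ∈ Γ := mem_of_forall_mem_dualLattice fun y hy => by
    simpa using hu y.1 ⟨y, hy, rfl⟩
  exact u_ne (congrArg Prod.fst (hsnd mem_lattice Γ.zero_mem rfl))

/-! ### Counting lattice points in a strip -/

section Counting

variable {W : Type*} [AddGroup W] [MeasurableSpace W] [MeasurableAdd W]
  {μ : Measure W} [μ.IsAddLeftInvariant] {Γ H : AddSubgroup W} [Countable Γ] {s F : Set W}

lemma measure_add_eq_encard_mul (hF : IsAddFundamentalDomain Γ F μ) (hs : s ⊆ Γ) :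
    μ (s + F) = s.encard * μ F := by
  have s_countable : s.Countable := (countable_coe_iff.1 ‹Countable Γ›).mono hs
  rw [← vadd_eq_add, ← iUnion_vadd_set, measure_biUnion₀ s_countable]
  · simp only [measure_vadd, ENNReal.tsum_set_const]
  · intro γ hγ γ' hγ' h_ne
    exact hF.aedisjoint (i := ⟨γ, hs hγ⟩) (j := ⟨γ', hs hγ'⟩) (by simpa using h_ne)
  · exact fun γ hγ => hF.nullMeasurableSet_vadd ⟨γ, hs hγ⟩

lemma isAddFundamentalDomain_add (hF : IsAddFundamentalDomain Γ F μ) (hs : s ⊆ Γ) (hH : H ≤ Γ)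
    (hsH : ∀ γ ∈ Γ, ∃! h : H, h + γ ∈ s) : IsAddFundamentalDomain H (s + F) μ := by
  have s_countable : Countable s := ((countable_coe_iff.1 ‹Countable Γ›).mono hs).to_subtype
  have add_eq : s + F = ⋃ γ : s, (γ : W) +ᵥ F := by
    rw [← vadd_eq_add, ← iUnion_vadd_set, biUnion_eq_iUnion]
  refine ⟨?_, ?_, fun h h' h_ne => ?_⟩
  · rw [add_eq]
    exact .iUnion fun γ => hF.nullMeasurableSet_vadd ⟨γ, hs γ.2⟩
  · filter_upwards [hF.ae_covers] with p ⟨γ, hγ⟩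
    obtain ⟨h, hh, -⟩ := hsH (-γ) (neg_mem γ.2)
    exact ⟨h, h + -γ, hh, γ + p, hγ, by simp [AddSubgroup.vadd_def, add_assoc]⟩
  · have vadd_eq (g : H) : g +ᵥ (s + F) = ⋃ γ : s, (g + γ : W) +ᵥ F := by
      simp only [add_eq, vadd_set_iUnion, AddSubgroup.vadd_def, vadd_vadd]
    simp only [Function.onFun, vadd_eq, AEDisjoint.iUnion_left_iff, AEDisjoint.iUnion_right_iff]
    intro γ' γ
    refine hF.aedisjoint (i := ⟨h + γ, add_mem (hH h.2) (hs γ.2)⟩)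
      (j := ⟨h' + γ', add_mem (hH h'.2) (hs γ'.2)⟩) fun h_eq => h_ne ?_
    have h_eq : (h + γ : W) = h' + γ' := congrArg Subtype.val h_eq
    refine neg_injective ((hsH (h + γ) (add_mem (hH h.2) (hs γ.2))).unique ?_ ?_)
    · simp
    · simp [h_eq]

end Counting

section Oblique

variable {E : Type*} [NormedAddCommGroup E] [NormedSpace ℝ E]

/-- The projection of `E × ℝ` onto `E` along the line spanned by `(w, 1)`. -/
noncomputable def obliqueProj (w : E) : E × ℝ →L[ℝ] E :=
  ContinuousLinearMap.fst ℝ E ℝ - (ContinuousLinearMap.snd ℝ E ℝ).smulRight w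

lemma obliqueProj_apply (w : E) (p : E × ℝ) : obliqueProj w p = p.1 - p.2 • w := rfl

lemma obliqueProj_inv_smul_fst {p : E × ℝ} (hp : p.2 ≠ 0) :
    obliqueProj (p.2⁻¹ • p.1) p = 0 := by
  rw [obliqueProj_apply, smul_inv_smul₀ hp, sub_self]

lemma exists_forall_dist_obliqueProj_le (w : E) {F : Set (E × ℝ)} {I : Set ℝ}
    (hF : Bornology.IsBounded F) (hI : Bornology.IsBounded I) :
    ∃ c, ∀ γ : E × ℝ, γ.2 ∈ I → ∀ f ∈ F, dist (obliqueProj w (γ + f)) γ.1 ≤ c := by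
  obtain ⟨r, hr⟩ := hF.exists_norm_le
  obtain ⟨m, hm⟩ := hI.exists_norm_le
  refine ⟨‖obliqueProj w‖ * r + m * ‖w‖, fun γ hγ f hf => ?_⟩
  calc dist (obliqueProj w (γ + f)) γ.1 = ‖obliqueProj w f - γ.2 • w‖ := by
        rw [dist_eq_norm, map_add, obliqueProj_apply w γ]
        congr 1
        abel
    _ ≤ ‖obliqueProj w f‖ + ‖γ.2 • w‖ := norm_sub_le _ _
    _ ≤ ‖obliqueProj w‖ * r + m * ‖w‖ := by
        rw [norm_smul]
        gcongr
        exacts [(obliqueProj w).le_opNorm_of_le (hr f hf), hm _ hγ]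

variable [MeasurableSpace E] [BorelSpace E] {μ : Measure E}

lemma prod_preimage_obliqueProj_inter [SecondCountableTopology E] [SFinite μ]
    [μ.IsAddLeftInvariant] (w : E) {A : Set E}
    {J : Set ℝ} (hA : MeasurableSet A) (hJ : MeasurableSet J) :
    μ.prod volume (obliqueProj w ⁻¹' A ∩ Prod.snd ⁻¹' J) = μ A * volume J := by
  rw [Measure.prod_apply_symm
      (((obliqueProj w).continuous.measurable hA).inter (measurable_snd hJ)),
    ← lintegral_indicator_const hJ]
  refine lintegral_congr fun t => ?_
  by_cases ht : t ∈ J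
  · have slice : (fun y => (y, t)) ⁻¹' (obliqueProj w ⁻¹' A ∩ Prod.snd ⁻¹' J) =
        (fun y => y + -(t • w)) ⁻¹' A := by
      ext y
      simp [obliqueProj_apply, ht, sub_eq_add_neg]
    rw [slice, indicator_of_mem ht, measure_preimage_add_right]
  · have slice : (fun y => (y, t)) ⁻¹' (obliqueProj w ⁻¹' A ∩ Prod.snd ⁻¹' J) = ∅ := by
      ext y
      simp [ht]
    rw [slice, indicator_of_notMem ht, measure_empty]

end Oblique

section Window

/-- A set of reals whose translates by the integer multiples of `ℓ` tile the line: the windows of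
length `ℓ` for which the counting argument works. -/
def TilesLine (I : Set ℝ) (ℓ : ℝ) : Prop :=
  ∀ t, ∃! n : ℤ, t + n • ℓ ∈ I

lemma tilesLine_Ico (a : ℝ) {ℓ : ℝ} (hℓ : 0 < ℓ) : TilesLine (Ico a (a + ℓ)) ℓ :=
  fun t => existsUnique_add_zsmul_mem_Ico hℓ t a

lemma tilesLine_Ioc (a : ℝ) {ℓ : ℝ} (hℓ : 0 < ℓ) : TilesLine (Ioc a (a + ℓ)) ℓ :=
  fun t => existsUnique_add_zsmul_mem_Ioc hℓ t a

lemma tilesLine_Ico_or_Ioc {a b : ℝ} (hab : a < b) {I : Set ℝ} (hI : I = Ico a b ∨ I = Ioc a b) :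
    TilesLine I (b - a) := by
  rcases hI with rfl | rfl
  · simpa using tilesLine_Ico a (sub_pos.2 hab)
  · simpa using tilesLine_Ioc a (sub_pos.2 hab)

lemma isBounded_Ico_or_Ioc {a b : ℝ} {I : Set ℝ} (hI : I = Ico a b ∨ I = Ioc a b) :
    Bornology.IsBounded I := by
  rcases hI with rfl | rfl
  exacts [Metric.isBounded_Ico a b, Metric.isBounded_Ioc a b]

variable {E : Type*} [NormedAddCommGroup E] {Γ : AddSubgroup (E × ℝ)} {γ₀ : E × ℝ}
  {I : Set ℝ} {F : Set (E × ℝ)}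

lemma TilesLine.existsUnique_zmultiples_add_mem (hI : TilesLine I γ₀.2) (p : E × ℝ) :
    ∃! h : AddSubgroup.zmultiples γ₀, (h + p).2 ∈ I := by
  obtain ⟨n, hn, n_unique⟩ := hI p.2
  refine ⟨⟨n • γ₀, n, rfl⟩, by simpa [add_comm] using hn, ?_⟩
  rintro ⟨_, m, rfl⟩ hm
  exact Subtype.ext (congrArg (· • γ₀) (n_unique m (by simpa [add_comm] using hm)))

variable [MeasurableSpace E] {μ : Measure E}

lemma isAddFundamentalDomain_zmultiples_snd_preimage (hI : TilesLine I γ₀.2)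
    (I_meas : MeasurableSet I) : IsAddFundamentalDomain (AddSubgroup.zmultiples γ₀)
      (Prod.snd ⁻¹' I : Set (E × ℝ)) (μ.prod volume) :=
  .mk' (measurable_snd I_meas).nullMeasurableSet hI.existsUnique_zmultiples_add_mem

variable [NormedSpace ℝ E] [FiniteDimensional ℝ E] [BorelSpace E] [μ.IsAddHaarMeasure] [Countable Γ]

/-- Lattice cells with base points in the strip over `I`, and a straight strip, are fundamental
domains of the same cyclic group, so a cylinder invariant under that group meets them in equal
volumes. -/
lemma prod_preimage_obliqueProj_inter_add (hF : IsAddFundamentalDomain Γ F (μ.prod volume))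
    (hγ₀ : γ₀ ∈ Γ) (hpos : 0 < γ₀.2) (hI : TilesLine I γ₀.2) {A : Set E} (hA : MeasurableSet A) :
    μ.prod volume (obliqueProj (γ₀.2⁻¹ • γ₀.1) ⁻¹' A ∩ ({γ | γ ∈ Γ ∧ γ.2 ∈ I} + F)) =
      μ A * ENNReal.ofReal γ₀.2 := by
  have zmultiples_le : AddSubgroup.zmultiples γ₀ ≤ Γ := AddSubgroup.zmultiples_le.2 hγ₀
  have cells_dom : IsAddFundamentalDomain (AddSubgroup.zmultiples γ₀)
      ({γ | γ ∈ Γ ∧ γ.2 ∈ I} + F) (μ.prod volume) := by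
    refine isAddFundamentalDomain_add hF (fun γ hγ => hγ.1) zmultiples_le fun γ hγ => ?_
    simpa only [mem_ofPred_eq, add_mem (zmultiples_le (Subtype.prop _)) hγ, true_and] using
      hI.existsUnique_zmultiples_add_mem γ
  have strip_dom := isAddFundamentalDomain_zmultiples_snd_preimage (μ := μ)
    (tilesLine_Ico 0 hpos) measurableSet_Ico
  have cylinder_invariant (h : AddSubgroup.zmultiples γ₀) :
      (h +ᵥ ·) ⁻¹' (obliqueProj (γ₀.2⁻¹ • γ₀.1) ⁻¹' A) = obliqueProj (γ₀.2⁻¹ • γ₀.1) ⁻¹' A := by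
    obtain ⟨_, n, rfl⟩ := h
    ext p
    simp [AddSubgroup.vadd_def, obliqueProj_inv_smul_fst hpos.ne']
  rw [cells_dom.measure_set_eq strip_dom ((obliqueProj _).continuous.measurable hA)
    cylinder_invariant, prod_preimage_obliqueProj_inter _ hA measurableSet_Ico]
  simp

theorem exists_encard_ball_bounds (hF : IsAddFundamentalDomain Γ F (μ.prod volume))
    (F_bdd : Bornology.IsBounded F) (I_bdd : Bornology.IsBounded I) (hγ₀ : γ₀ ∈ Γ)
    (hpos : 0 < γ₀.2) (hI : TilesLine I γ₀.2) :
    ∃ c, ∀ x R,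
      {γ | γ ∈ Γ ∧ γ.2 ∈ I ∧ γ.1 ∈ Metric.ball x R}.encard * μ.prod volume F ≤
        μ (Metric.ball x (R + c)) * ENNReal.ofReal γ₀.2 ∧
      μ (Metric.ball x (R - c)) * ENNReal.ofReal γ₀.2 ≤
        {γ | γ ∈ Γ ∧ γ.2 ∈ I ∧ γ.1 ∈ Metric.ball x R}.encard * μ.prod volume F := by
  obtain ⟨c, hc⟩ := exists_forall_dist_obliqueProj_le (γ₀.2⁻¹ • γ₀.1) F_bdd I_bdd
  refine ⟨c, fun x R => ?_⟩
  simp only [← measure_add_eq_encard_mul (s := {γ | γ ∈ Γ ∧ γ.2 ∈ I ∧ γ.1 ∈ Metric.ball x R}) hF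
      fun _ hγ => hγ.1,
    ← prod_preimage_obliqueProj_inter_add hF hγ₀ hpos hI measurableSet_ball]
  constructor
  · refine measure_mono ?_
    rintro _ ⟨γ, ⟨hγ, hγI, hγB⟩, f, hf, rfl⟩
    refine ⟨?_, γ, ⟨hγ, hγI⟩, f, hf, rfl⟩
    rw [mem_preimage, Metric.mem_ball]
    linarith [dist_triangle (obliqueProj (γ₀.2⁻¹ • γ₀.1) (γ + f)) γ.1 x, hc γ hγI f hf,
      Metric.mem_ball.1 hγB]
  · refine measure_mono ?_
    rintro _ ⟨hB, γ, ⟨hγ, hγI⟩, f, hf, rfl⟩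
    refine ⟨γ, ⟨hγ, hγI, ?_⟩, f, hf, rfl⟩
    rw [Metric.mem_ball]
    linarith [dist_triangle_left γ.1 x (obliqueProj (γ₀.2⁻¹ • γ₀.1) (γ + f)), hc γ hγI f hf,
      Metric.mem_ball.1 hB]

end Window

/-! ### Uniform density -/

section Density

lemma tendsto_addHaar_ball_add_div {E : Type*} [NormedAddCommGroup E] [NormedSpace ℝ E]
    [FiniteDimensional ℝ E] [MeasurableSpace E] [BorelSpace E] (μ : Measure E)
    [μ.IsAddHaarMeasure] (x : E) (c : ℝ) :
    Tendsto (fun R : ℝ => μ (Metric.ball x (R + c)) / μ (Metric.ball x R)) atTop (nhds 1) := by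
  have ratio_tendsto : Tendsto (fun R : ℝ => (1 + c * R⁻¹) ^ Module.finrank ℝ E) atTop
      (nhds ((1 + c * 0) ^ Module.finrank ℝ E)) :=
    ((tendsto_inv_atTop_zero.const_mul c).const_add 1).pow _
  rw [mul_zero, add_zero, one_pow] at ratio_tendsto
  refine (ENNReal.ofReal_one ▸ ENNReal.tendsto_ofReal ratio_tendsto).congr' ?_
  filter_upwards [eventually_gt_atTop 0, eventually_gt_atTop (-c)] with R hR hRc
  have hRc' : 0 < R + c := by linarith
  rw [Measure.addHaar_ball_of_pos _ _ hRc', Measure.addHaar_ball_of_pos _ _ hR,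
    ENNReal.mul_div_mul_right _ _ (Metric.measure_ball_pos _ _ one_pos).ne' measure_ball_lt_top.ne,
    ← ENNReal.ofReal_div_of_pos (by positivity), ← div_pow, add_div, div_self hR.ne',
    div_eq_mul_inv c]

variable {d : ℕ}

lemma hasUniformDensity_of_encard_bounds {Λ : Set (EuclideanSpace ℝ (Fin d))} {D : ℝ≥0∞} {c : ℝ}
    (upper : ∀ x R, (Λ ∩ Metric.ball x R).encard ≤ D * volume (Metric.ball x (R + c)))
    (lower : ∀ x R, D * volume (Metric.ball x (R - c)) ≤ (Λ ∩ Metric.ball x R).encard) :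
    HasUniformDensity Λ D := by
  have bound_tendsto (c : ℝ) : Tendsto (fun R : ℝ =>
      D * volume (Metric.ball (0 : EuclideanSpace ℝ (Fin d)) (R + c)) /
        volume (Metric.ball (0 : EuclideanSpace ℝ (Fin d)) R)) atTop (nhds D) := by
    simpa [mul_div_assoc] using ENNReal.Tendsto.const_mul
      (tendsto_addHaar_ball_add_div volume (0 : EuclideanSpace ℝ (Fin d)) c) (.inl one_ne_zero)
  have le_ratio (R : ℝ) (x : EuclideanSpace ℝ (Fin d)) :
      D * volume (Metric.ball (0 : EuclideanSpace ℝ (Fin d)) (R + -c)) /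
        volume (Metric.ball (0 : EuclideanSpace ℝ (Fin d)) R) ≤
      (Λ ∩ Metric.ball x R).encard / volume (Metric.ball (0 : EuclideanSpace ℝ (Fin d)) R) := by
    rw [← Measure.addHaar_ball_center volume x, ← sub_eq_add_neg]
    exact ENNReal.div_le_div_right (lower x R) _
  have ratio_le (R : ℝ) (x : EuclideanSpace ℝ (Fin d)) :
      (Λ ∩ Metric.ball x R).encard / volume (Metric.ball (0 : EuclideanSpace ℝ (Fin d)) R) ≤
      D * volume (Metric.ball (0 : EuclideanSpace ℝ (Fin d)) (R + c)) /
        volume (Metric.ball (0 : EuclideanSpace ℝ (Fin d)) R) := by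
    rw [← Measure.addHaar_ball_center volume x (R + c)]
    exact ENNReal.div_le_div_right (upper x R) _
  constructor
  · exact (tendsto_of_tendsto_of_tendsto_of_le_of_le (bound_tendsto (-c)) (bound_tendsto c)
      (fun R => le_iInf (le_ratio R)) fun R => iInf_le_of_le 0 (ratio_le R 0)).liminf_eq
  · exact (tendsto_of_tendsto_of_tendsto_of_le_of_le (bound_tendsto (-c)) (bound_tendsto c)
      (fun R => le_iSup_of_le 0 (le_ratio R 0)) fun R => iSup_le (ratio_le R)).limsup_eq

variable {Γ : Submodule ℤ (EuclideanSpace ℝ (Fin d) × ℝ)} {I : Set ℝ}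

lemma encard_modelSet_inter (hfst : InjOn Prod.fst (Γ : Set (EuclideanSpace ℝ (Fin d) × ℝ)))
    (B : Set (EuclideanSpace ℝ (Fin d))) :
    (modelSet Γ I ∩ B).encard = {γ | γ ∈ Γ ∧ γ.2 ∈ I ∧ γ.1 ∈ B}.encard := by
  have image_eq : modelSet Γ I ∩ B = Prod.fst '' {γ | γ ∈ Γ ∧ γ.2 ∈ I ∧ γ.1 ∈ B} := by
    ext x
    constructor
    · rintro ⟨⟨γ, hγ, hI, rfl⟩, hB⟩
      exact ⟨γ, ⟨hγ, hI, hB⟩, rfl⟩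
    · rintro ⟨γ, ⟨hγ, hI, hB⟩, rfl⟩
      exact ⟨⟨γ, hγ, hI, rfl⟩, hB⟩
  rw [image_eq, (hfst.mono fun γ hγ => hγ.1).encard_image]

variable [DiscreteTopology Γ] [IsZLattice ℝ Γ]

lemma exists_isAddFundamentalDomain_isBounded :
    ∃ F : Set (EuclideanSpace ℝ (Fin d) × ℝ),
      IsAddFundamentalDomain Γ.toAddSubgroup F ∧ Bornology.IsBounded F ∧
      volume F = ENNReal.ofReal (ZLattice.covolume Γ) := by
  let e := Module.Free.chooseBasis ℤ Γ
  have F_bdd := ZSpan.fundamentalDomain_isBounded (e.ofZLatticeBasis ℝ Γ)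
  refine ⟨_, ZLattice.isAddFundamentalDomain e volume, F_bdd, ?_⟩
  rw [ZLattice.covolume_eq_measure_fundamentalDomain Γ volume
    (ZLattice.isAddFundamentalDomain e volume), measureReal_def,
    ENNReal.ofReal_toReal F_bdd.measure_lt_top.ne]

theorem hasUniformDensity_modelSet
    (hfst : InjOn Prod.fst (Γ : Set (EuclideanSpace ℝ (Fin d) × ℝ)))
    {γ₀ : EuclideanSpace ℝ (Fin d) × ℝ} (hγ₀ : γ₀ ∈ Γ) (hpos : 0 < γ₀.2)
    (I_bdd : Bornology.IsBounded I) (hI : TilesLine I γ₀.2) :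
    HasUniformDensity (modelSet Γ I) (ENNReal.ofReal (γ₀.2 / ZLattice.covolume Γ)) := by
  obtain ⟨F, hF, F_bdd, F_vol⟩ := exists_isAddFundamentalDomain_isBounded (Γ := Γ)
  have : Countable Γ.toAddSubgroup := inferInstanceAs (Countable Γ)
  obtain ⟨c, hc⟩ := exists_encard_ball_bounds hF F_bdd I_bdd hγ₀ hpos hI
  have covol_pos := ZLattice.covolume_pos Γ volume
  have density_mul (V : ℝ≥0∞) : ENNReal.ofReal (γ₀.2 / ZLattice.covolume Γ) * V =
      V * ENNReal.ofReal γ₀.2 / volume F := by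
    rw [F_vol, ENNReal.ofReal_div_of_pos covol_pos, mul_comm, mul_div_assoc]
  have vol_ne_zero : volume F ≠ 0 := by simpa [F_vol] using covol_pos
  have vol_ne_top : volume F ≠ ∞ := F_vol ▸ ENNReal.ofReal_ne_top
  refine hasUniformDensity_of_encard_bounds (c := c) (fun x R => ?_) fun x R => ?_
  · rw [density_mul, encard_modelSet_inter hfst,
      ENNReal.le_div_iff_mul_le (.inl vol_ne_zero) (.inl vol_ne_top)]
    exact (hc x R).1
  · rw [density_mul, encard_modelSet_inter hfst, ENNReal.div_le_iff vol_ne_zero vol_ne_top]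
    exact (hc x R).2

end Density

lemma dim_ne_zero_of_injOn_fst {d : ℕ} {Γ : Submodule ℤ (EuclideanSpace ℝ (Fin d) × ℝ)}
    [DiscreteTopology Γ] [IsZLattice ℝ Γ]
    (hfst : InjOn Prod.fst (Γ : Set (EuclideanSpace ℝ (Fin d) × ℝ))) :
    d ≠ 0 := by
  rintro rfl
  have subset_zero : (Γ : Set (EuclideanSpace ℝ (Fin 0) × ℝ)) ⊆ {0} := fun γ hγ =>
    hfst hγ Γ.zero_mem (Subsingleton.elim _ _)
  have span_eq_bot : Submodule.span ℝ (Γ : Set (EuclideanSpace ℝ (Fin 0) × ℝ)) = ⊥ :=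
    Submodule.span_eq_bot.2 fun x hx => subset_zero hx
  exact bot_ne_top (span_eq_bot.symm.trans IsZLattice.span_top)

lemma riemannMeasurable_parallelepiped {d : ℕ} (v : Fin d → EuclideanSpace ℝ (Fin d)) :
    RiemannMeasurable (parallelepiped v) :=
  .of_convex (convex_parallelepiped v) (isCompact_Icc.image (by fun_prop)).isBounded

end Quasicrystal

theorem mainTheorem5_general {d : ℕ} {Γ : Submodule ℤ (EuclideanSpace ℝ (Fin d) × ℝ)}
    [DiscreteTopology Γ] [IsZLattice ℝ Γ]
    (hfst : InjOn Prod.fst (Γ : Set (EuclideanSpace ℝ (Fin d) × ℝ)))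
    (hsnd : InjOn Prod.snd (Γ : Set (EuclideanSpace ℝ (Fin d) × ℝ)))
    {ℓ : ℝ} (hℓ : 0 < ℓ) {I : Set ℝ} (I_bdd : Bornology.IsBounded I)
    (hI : Quasicrystal.TilesLine I ℓ) (hlen : ∃ γ ∈ Γ, γ.2 = ℓ) :
    Quasicrystal.HasUniformDensity (Quasicrystal.modelSet Γ I)
      (ENNReal.ofReal (ℓ / ZLattice.covolume Γ)) ∧
    ∀ D : ℝ≥0∞, Quasicrystal.HasUniformDensity (Quasicrystal.modelSet Γ I) D →
    ∀ K U : Set (EuclideanSpace ℝ (Fin d)), IsCompact K → IsOpen U → K ⊆ U →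
      volume K < D → D < volume U →
      ∃ S : Set (EuclideanSpace ℝ (Fin d)),
        Quasicrystal.RiemannMeasurable S ∧ K ⊆ S ∧ S ⊆ U ∧ volume S = D ∧
        ∃ v : Fin d → EuclideanSpace ℝ (Fin d),
          (∀ i, v i ∈ Quasicrystal.dualProj Γ) ∧ LinearIndependent ℝ v ∧
          Quasicrystal.EquidecomposableByTranslations (Quasicrystal.dualProj Γ) S
            (parallelepiped v) := by
  obtain ⟨γ, hγ, rfl⟩ := hlen
  have density := Quasicrystal.hasUniformDensity_modelSet hfst hγ hℓ I_bdd hI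
  refine ⟨density, fun D hD K U hK hU hKU hKD hDU => ?_⟩
  obtain ⟨v, hv, v_indep, v_vol⟩ := Quasicrystal.exists_dual_parallelepiped
    (Quasicrystal.dim_ne_zero_of_injOn_fst hfst) hγ hℓ
  obtain rfl : D = volume (parallelepiped v) := by rw [v_vol, ← hD.1, density.1]
  obtain ⟨S, hKS, hSU, hSv⟩ := Quasicrystal.exists_strictlyEquidecomposable_between
    (Quasicrystal.dense_dualProj hsnd) (Quasicrystal.riemannMeasurable_parallelepiped v)
    hK hU hKU hKD hDU
  exact ⟨S, hSv.riemannMeasurable_left, hKS, hSU, hSv.volume_eq, v, hv, v_indep,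
    hSv.equidecomposableByTranslations⟩

theorem mainTheorem5 (d : ℕ)
    (Γ : Submodule ℤ (EuclideanSpace ℝ (Fin d) × ℝ)) [DiscreteTopology Γ] [IsZLattice ℝ Γ]
    (hΓ : Quasicrystal.GeneralPosition Γ)
    (a b : ℝ) (hab : a < b) (I : Set ℝ) (hI : I = Set.Ico a b ∨ I = Set.Ioc a b)
    (hlen : ∃ γ ∈ Γ, γ.2 = b - a) :
    Quasicrystal.HasUniformDensity (Quasicrystal.modelSet Γ I)
      (ENNReal.ofReal ((b - a) / ZLattice.covolume Γ)) ∧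
    ∀ D : ℝ≥0∞, Quasicrystal.HasUniformDensity (Quasicrystal.modelSet Γ I) D →
    ∀ K U : Set (EuclideanSpace ℝ (Fin d)), IsCompact K → IsOpen U → K ⊆ U →
      volume K < D → D < volume U →
      ∃ S : Set (EuclideanSpace ℝ (Fin d)),
        Quasicrystal.RiemannMeasurable S ∧ K ⊆ S ∧ S ⊆ U ∧
        volume S = D ∧
        ∃ v : Fin d → EuclideanSpace ℝ (Fin d),
          (∀ i, v i ∈ Quasicrystal.dualProj Γ) ∧
          LinearIndependent ℝ v ∧
          Quasicrystal.EquidecomposableByTranslations (Quasicrystal.dualProj Γ) S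
            (parallelepiped v) :=
  mainTheorem5_general hΓ.injOn_fst hΓ.injOn_snd (sub_pos.2 hab)
    (Quasicrystal.isBounded_Ico_or_Ioc hI) (Quasicrystal.tilesLine_Ico_or_Ioc hab hI) hlen
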